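/- Let $(M,g)$ be a smooth $m$-dimensional Riemannian manifold with Levi-Civita connection $\nabla$, let $f:M\to\mathbb{R}$ be a smooth function, let $\xi:=\operatorname{grad}(f)$ be its gradient, and let $\eta$ be the $1$-form $g$-dual to $\xi$, $\eta(X):=g(X,\xi)$. Write $\operatorname{Hess}(f):=\nabla(df)$, that is, $\operatorname{Hess}(f)(X,Y)=X(df(Y))-df(\nabla_XY)$; $R(X,Y)Z:=\nabla_X\nabla_YZ-\nabla_Y\nabla_XZ-\nabla_{[X,Y]}Z$ for the Riemann curvature; and $S(X,Y):=\operatorname{trace}(Z\mapsto R(Z,X)Y)=\sum_{i=1}^m g(R(E_i,X)Y,E_i)$ for the Ricci curvature, where $\{E_i\}$ is a local orthonormal frame. Suppose that $\nabla\xi=I-\eta\otimes\xi$, that is, $\nabla_X\xi=X-\eta(X)\xi$ for every vector field $X$. Then: \begin{enumerate} \item $\operatorname{Hess}(f)=g-\eta\otimes\eta$, that is, $\operatorname{Hess}(f)(X,Y)=g(X,Y)-\eta(X)\eta(Y)$ for all smooth vector fields $X,Y$ on $M$; \item $R(X,Y)\xi=\eta(X)Y-\eta(Y)X$ for all smooth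 vector fields $X,Y$ on $M$; \item $S(\xi,\xi)=(1-m)|\xi|^2$. \end{enumerate} -/

import Mathlib

open Bundle FiberBundle VectorField
open scoped Manifold ContDiff

noncomputable section

namespace RiemGeom

/-- A smooth (global) vector field. -/
def IsSmoothField {E : Type*} [NormedAddCommGroup E] [NormedSpace ℝ E]
    {H : Type*} [TopologicalSpace H] {I : ModelWithCorners ℝ E H}
    {M : Type*} [TopologicalSpace M] [ChartedSpace H M] [IsManifold I ∞ M]
    (X : Π x : M, TangentSpace I x) : Prop :=
  ContMDiff I I.tangent ∞ (fun x ↦ (⟨x, X x⟩ : TangentBundle I M))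

section Metric

variable {E : Type*} [NormedAddCommGroup E] [NormedSpace ℝ E]
  {H : Type*} [TopologicalSpace H] {I : ModelWithCorners ℝ E H}
  {M : Type*} [TopologicalSpace M] [ChartedSpace H M]
  [RiemannianBundle (fun x : M ↦ TangentSpace I x)]

/-- The right-hand side of Koszul's formula for `2 g(∇_X Y, Z)`, at the point `x`. -/
def koszul (X Y Z : Π x : M, TangentSpace I x) (x : M) : ℝ :=
  d% (fun y ↦ inner ℝ (Y y) (Z y)) x (X x)
    + d% (fun y ↦ inner ℝ (Z y) (X y)) x (Y x)
    - d% (fun y ↦ inner ℝ (X y) (Y y)) x (Z x)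
    - inner ℝ (X x) (mlieBracket I Y Z x)
    + inner ℝ (Y x) (mlieBracket I Z X x)
    + inner ℝ (Z x) (mlieBracket I X Y x)

/-- The one-form dual to a vector field with respect to the metric, `v ↦ g(X, v)`. -/
def flat (X : Π x : M, TangentSpace I x) (x : M) : TangentSpace I x →L[ℝ] ℝ :=
  innerSL ℝ (X x)

theorem mdiffAt_inner [IsManifold I ∞ M]
    [IsContMDiffRiemannianBundle I ∞ E (fun x : M ↦ TangentSpace I x)]
    {x : M} {X Y : Π x : M, TangentSpace I x}
    (hX : MDiffAt (T% X) x) (hY : MDiffAt (T% Y) x) :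
    MDiffAt (fun y ↦ inner ℝ (X y) (Y y)) x :=
  MDifferentiableAt.inner_bundle (F := E) (E := fun x : M ↦ TangentSpace I x) hX hY

theorem clm_ext_of_fields [IsManifold I ∞ M] {x : M} {A B : TangentSpace I x →L[ℝ] TangentSpace I x}
    (h : ∀ X Z : Π x : M, TangentSpace I x, MDiffAt (T% X) x → MDiffAt (T% Z) x →
      2 * inner ℝ (A (X x)) (Z x) = 2 * inner ℝ (B (X x)) (Z x)) : A = B := by
  ext1 v
  refine ext_inner_right ℝ fun w ↦ ?_
  have := h (extend E v) (extend E w) (mdifferentiableAt_extend ..) (mdifferentiableAt_extend ..)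
  simp only [extend_apply_self] at this
  linarith

variable [FiniteDimensional ℝ E]

instance finiteDimensional_tangentSpace (x : M) : FiniteDimensional ℝ (TangentSpace I x) :=
  inferInstanceAs (FiniteDimensional ℝ E)

instance completeSpace_tangentSpace (x : M) : CompleteSpace (TangentSpace I x) :=
  FiniteDimensional.complete ℝ (TangentSpace I x)

/-- The vector that represents a covector with respect to the metric. -/
def sharp (x : M) : (TangentSpace I x →L[ℝ] ℝ) →L[ℝ] TangentSpace I x :=
  LinearMap.toContinuousLinearMap
    { toFun := fun α ↦ (InnerProductSpace.toDual ℝ (TangentSpace I x)).symm α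
      map_add' := fun α β ↦ map_add _ α β
      map_smul' := fun c α ↦ by simp }

theorem inner_sharp (x : M) (α : TangentSpace I x →L[ℝ] ℝ) (v : TangentSpace I x) :
    inner ℝ (sharp x α) v = α v :=
  InnerProductSpace.toDual_symm_apply

/-- The gradient of a function: `g(grad f, v) = df(v)`. -/
def grad (f : M → ℝ) (x : M) : TangentSpace I x := sharp x (d% f x)

end Metric

section LeviCivita

variable {E : Type*} [NormedAddCommGroup E] [NormedSpace ℝ E] [FiniteDimensional ℝ E]
  {H : Type*} [TopologicalSpace H] {I : ModelWithCorners ℝ E H}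
  {M : Type*} [TopologicalSpace M] [ChartedSpace H M] [IsManifold I ∞ M]
  [RiemannianBundle (fun x : M ↦ TangentSpace I x)]
  [IsContMDiffRiemannianBundle I ∞ E (fun x : M ↦ TangentSpace I x)]

theorem koszul_tensorial_left {x : M} {Y Z : Π x : M, TangentSpace I x}
    (hY : MDiffAt (T% Y) x) (hZ : MDiffAt (T% Z) x) :
    TensorialAt I E (fun X : Π x : M, TangentSpace I x ↦ koszul X Y Z x) x where
  smul {f X} hf hX := by
    have := FiniteDimensional.complete ℝ E
    simp [koszul, mlieBracket_smul_left hf hX, mlieBracket_smul_right hf hX,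
      mvfderiv_fun_mul hf (mdiffAt_inner hX hY), mvfderiv_fun_mul hf (mdiffAt_inner hZ hX),
      inner_add_right, inner_smul_left, inner_smul_right]
    rw [real_inner_comm (X x) (Y x)]
    ring
  add {X X'} hX hX' := by
    have := FiniteDimensional.complete ℝ E
    simp [koszul, mlieBracket_add_left hX hX', mlieBracket_add_right hX hX',
      mvfderiv_fun_add (mdiffAt_inner hX hY) (mdiffAt_inner hX' hY),
      mvfderiv_fun_add (mdiffAt_inner hZ hX) (mdiffAt_inner hZ hX'),
      inner_add_right, inner_add_left]
    ring

theorem koszul_tensorial_right {x : M} {X Y : Π x : M, TangentSpace I x}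
    (hX : MDiffAt (T% X) x) (hY : MDiffAt (T% Y) x) :
    TensorialAt I E (fun Z : Π x : M, TangentSpace I x ↦ koszul X Y Z x) x where
  smul {f Z} hf hZ := by
    have := FiniteDimensional.complete ℝ E
    simp [koszul, mlieBracket_smul_left hf hZ, mlieBracket_smul_right hf hZ,
      mvfderiv_fun_mul hf (mdiffAt_inner hY hZ), mvfderiv_fun_mul hf (mdiffAt_inner hZ hX),
      inner_add_right, inner_smul_left, inner_smul_right]
    rw [real_inner_comm (X x) (Z x)]
    ring
  add {Z Z'} hZ hZ' := by
    have := FiniteDimensional.complete ℝ E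
    simp [koszul, mlieBracket_add_left hZ hZ', mlieBracket_add_right hZ hZ',
      mvfderiv_fun_add (mdiffAt_inner hY hZ) (mdiffAt_inner hY hZ'),
      mvfderiv_fun_add (mdiffAt_inner hZ hX) (mdiffAt_inner hZ' hX),
      inner_add_right, inner_add_left]
    ring

open scoped Classical in
/-- `∇ Y` at `x` as the map `v ↦ ∇_v Y`, for the Levi-Civita connection `∇`: the vector `∇_v Y`
represents `w ↦ (1/2) koszul(v, Y, w)`. A field that is not differentiable at `x` gets the
value `0` there. -/
def leviCivitaFun (Y : Π x : M, TangentSpace I x) (x : M) :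
    TangentSpace I x →L[ℝ] TangentSpace I x :=
  if hY : MDiffAt (T% Y) x then
    sharp x ∘L
      ((1 / 2 : ℝ) • TensorialAt.mkHom₂ (fun X Z : Π x : M, TangentSpace I x ↦ koszul X Y Z x) x
        (fun _ hZ ↦ koszul_tensorial_left hY hZ) (fun _ hX ↦ koszul_tensorial_right hX hY))
  else 0

theorem inner_leviCivitaFun {x : M} {X Y Z : Π x : M, TangentSpace I x}
    (hX : MDiffAt (T% X) x) (hY : MDiffAt (T% Y) x) (hZ : MDiffAt (T% Z) x) :
    2 * inner ℝ (leviCivitaFun Y x (X x)) (Z x) = koszul X Y Z x := by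
  have h := TensorialAt.mkHom₂_apply
    (Φ := fun X Z : Π x : M, TangentSpace I x ↦ koszul X Y Z x)
    (fun _ hZ ↦ koszul_tensorial_left hY hZ) (fun _ hX ↦ koszul_tensorial_right hX hY) hX hZ
  rw [leviCivitaFun, dif_pos hY, ← h]
  simp [inner_sharp, inner_smul_left]

/-- The Levi-Civita connection of the metric, given by Koszul's formula
`2 g(∇_X Y, Z) = koszul(X, Y, Z)`. As for every `CovariantDerivative`, `leviCivita Y x (X x)`
is `∇_X Y` at `x`. -/
def leviCivita : CovariantDerivative I E (fun x : M ↦ TangentSpace I x) where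
  toFun := leviCivitaFun
  isCovariantDerivativeOnUniv :=
    { add := by
        intro Y Y' x hY hY' _
        have := FiniteDimensional.complete ℝ E
        refine clm_ext_of_fields fun X Z hX hZ ↦ ?_
        rw [inner_leviCivitaFun hX (mdifferentiableAt_add_section hY hY') hZ]
        simp only [add_apply, inner_add_left, mul_add]
        rw [inner_leviCivitaFun hX hY hZ, inner_leviCivitaFun hX hY' hZ]
        simp [koszul, mlieBracket_add_left hY hY', mlieBracket_add_right hY hY',
          mvfderiv_fun_add (mdiffAt_inner hY hZ) (mdiffAt_inner hY' hZ),
          mvfderiv_fun_add (mdiffAt_inner hX hY) (mdiffAt_inner hX hY'),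
          inner_add_right, inner_add_left]
        ring
      leibniz := by
        intro Y f x hY hf _
        have := FiniteDimensional.complete ℝ E
        refine clm_ext_of_fields fun X Z hX hZ ↦ ?_
        rw [inner_leviCivitaFun hX (hf.smul_section hY) hZ]
        have h := inner_leviCivitaFun hX hY hZ
        simp only [add_apply, smul_apply,
          ContinuousLinearMap.smulRight_apply, inner_add_left, inner_smul_left, mul_add]
        simp only [RCLike.conj_to_real, mul_left_comm (2 : ℝ) (f x)]
        rw [h]
        simp [koszul, mlieBracket_smul_left hf hY, mlieBracket_smul_right hf hY,
          mvfderiv_fun_mul hf (mdiffAt_inner hY hZ), mvfderiv_fun_mul hf (mdiffAt_inner hX hY),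
          inner_add_right, inner_smul_left, inner_smul_right]
        rw [real_inner_comm (Y x) (Z x)]
        ring }

theorem leviCivita_torsion :
    (leviCivita : CovariantDerivative I E (fun x : M ↦ TangentSpace I x)).torsion = 0 := by
  have := FiniteDimensional.complete ℝ E
  rw [CovariantDerivative.torsion_eq_zero_iff]
  intro X Y x hX hY
  refine ext_inner_right ℝ fun w ↦ ?_
  have hW : MDiffAt (T% (extend E w)) x := mdifferentiableAt_extend (I := I) (F := E) w
  have h1 := inner_leviCivitaFun hX hY hW
  have h2 := inner_leviCivitaFun hY hX hW
  have e1 := mlieBracket_swap_apply (I := I) (V := Y) (W := X) (x := x)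
  have e2 := mlieBracket_swap_apply (I := I) (V := extend E w) (W := X) (x := x)
  have e3 := mlieBracket_swap_apply (I := I) (V := extend E w) (W := Y) (x := x)
  simp only [koszul, extend_apply_self, e1, e2, e3, inner_neg_right,
    fun y ↦ real_inner_comm (X y) (Y y), fun y ↦ real_inner_comm (X y) (extend E w y),
    fun y ↦ real_inner_comm (Y y) (extend E w y)] at h1 h2
  rw [inner_sub_left, real_inner_comm w (mlieBracket I X Y x)]
  change inner ℝ (leviCivitaFun Y x (X x)) w - inner ℝ (leviCivitaFun X x (Y x)) w = _
  linarith

theorem leviCivita_metric {x : M} {X Y Z : Π x : M, TangentSpace I x}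
    (hX : MDiffAt (T% X) x) (hY : MDiffAt (T% Y) x) (hZ : MDiffAt (T% Z) x) :
    d% (fun y ↦ inner ℝ (Y y) (Z y)) x (X x) =
      inner ℝ (leviCivita Y x (X x)) (Z x) + inner ℝ (Y x) (leviCivita Z x (X x)) := by
  have h1 := inner_leviCivitaFun hX hY hZ
  have h2 := inner_leviCivitaFun hX hZ hY
  have e1 := mlieBracket_swap_apply (I := I) (V := Y) (W := X) (x := x)
  have e2 := mlieBracket_swap_apply (I := I) (V := Z) (W := X) (x := x)
  have e3 := mlieBracket_swap_apply (I := I) (V := Z) (W := Y) (x := x)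
  simp only [koszul, e1, e2, e3, inner_neg_right,
    fun y ↦ real_inner_comm (X y) (Y y), fun y ↦ real_inner_comm (X y) (Z y),
    fun y ↦ real_inner_comm (Y y) (Z y)] at h1 h2 ⊢
  rw [real_inner_comm _ (Y x)]
  change _ = inner ℝ (leviCivitaFun Y x (X x)) (Z x) + inner ℝ (leviCivitaFun Z x (X x)) (Y x)
  linarith

/-- The Hessian `∇(df)` of `f`: `(∇_X df)(Y) = X(df(Y)) - df(∇_X Y)`. -/
def hess (f : M → ℝ) (X Y : Π x : M, TangentSpace I x) (x : M) : ℝ :=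
  d% (fun y ↦ d% f y (Y y)) x (X x) - d% f x (leviCivita Y x (X x))

/-- The Riemann curvature `R(X, Y)Z = ∇_X ∇_Y Z - ∇_Y ∇_X Z - ∇_{[X, Y]} Z`. -/
def curvature (X Y Z : Π x : M, TangentSpace I x) (x : M) : TangentSpace I x :=
  leviCivita (fun y ↦ leviCivita Z y (Y y)) x (X x)
    - leviCivita (fun y ↦ leviCivita Z y (X y)) x (Y x)
    - leviCivita Z x (mlieBracket I X Y x)

/-- The Ricci curvature `S(X, Y) = ∑ i, g(R(E i, X)Y, E i)`, the trace of `Z ↦ R(Z, X)Y`, where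
`E i` are fields, smooth near `x`, that form an orthonormal basis of the tangent space at `x`. -/
def ricci (X Y : Π x : M, TangentSpace I x) (x : M) : ℝ :=
  ∑ i, inner ℝ (curvature (extend E (stdOrthonormalBasis ℝ (TangentSpace I x) i)) X Y x)
    (stdOrthonormalBasis ℝ (TangentSpace I x) i)

end LeviCivita

end RiemGeom

end

/-! By metric compatibility, Hess f(X, Y) = g(∇_X ξ, Y), and inserting ∇ξ = I - η ⊗ ξ gives the
first claim (`hess_eq_inner`). For the second, differentiate the equation once more: ∇_X(Y - η(Y)ξ)
is expanded by the Leibniz rule and metric compatibility (`leviCivita_sub_inner_smul`).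
Antisymmetrising in X and Y kills the symmetric terms, and torsion-freeness cancels those with ∇_X Y
- ∇_Y X against ∇_{[X, Y]}ξ, leaving η(X)Y - η(Y)X. Tracing this over an orthonormal basis gives the
third.

These rules need differentiable fields, so ξ must first be shown regular: the coefficients of grad f
in a local frame solve a linear system with the smooth Gram matrix and smooth right-hand side. -/

noncomputable section
namespace RiemGeom

/-! ### Smooth linear systems and derivatives along smooth fields. -/

section Smoothness

variable {E : Type*} [NormedAddCommGroup E] [NormedSpace ℝ E]
  {H : Type*} [TopologicalSpace H] {I : ModelWithCorners ℝ E H}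
  {M : Type*} [TopologicalSpace M] [ChartedSpace H M]

/-- The solution of a linear system with `C^n` coefficients that is injective near `x` is `C^n`
at `x`. -/
theorem contMDiffAt_of_linear_system {ι : Type*} [Fintype ι] [DecidableEq ι] {n : ℕ∞ω} {x : M}
    {G : ι → ι → M → ℝ} {c : ι → M → ℝ}
    (hG : ∀ i j, ContMDiffAt I 𝓘(ℝ) n (G i j) x)
    (hGc : ∀ j, ContMDiffAt I 𝓘(ℝ) n (fun y ↦ ∑ i, c i y * G i j y) x)
    (hinj : ∀ᶠ y in nhds x, ∀ a : ι → ℝ, (∀ j, ∑ i, a i * G i j y = 0) → a = 0) (i : ι) :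
    ContMDiffAt I 𝓘(ℝ) n (c i) x := by
  let Φ : M → (ι → ℝ) →L[ℝ] (ι → ℝ) := fun y ↦ ∑ i, ∑ j, G i j y •
    (ContinuousLinearMap.single ℝ (fun _ : ι ↦ ℝ) j ∘L ContinuousLinearMap.proj i)
  have hΦ : ContMDiffAt I 𝓘(ℝ, (ι → ℝ) →L[ℝ] (ι → ℝ)) n Φ x :=
    ContMDiffAt.sum fun i _ ↦ ContMDiffAt.sum fun j _ ↦ (hG i j).smul contMDiffAt_const
  have happ (y : M) (a : ι → ℝ) (j : ι) : Φ y a j = ∑ i, a i * G i j y := by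
    simp [Φ, Finset.sum_apply, Pi.single_apply, mul_comm]
  have hinv : ∀ᶠ y in nhds x, (Φ y).IsInvertible := by
    filter_upwards [hinj] with y hy
    have hi : Function.Injective (Φ y : (ι → ℝ) →ₗ[ℝ] (ι → ℝ)) := by
      rw [← LinearMap.ker_eq_bot, LinearMap.ker_eq_bot']
      exact fun a ha ↦ hy a fun j ↦ by rw [← happ]; exact congrFun ha j
    exact ⟨(LinearEquiv.ofInjectiveEndo _ hi).toContinuousLinearEquiv, by ext; rfl⟩
  have hb : ContMDiffAt I 𝓘(ℝ, ι → ℝ) n (fun y ↦ Φ y (fun i ↦ c i y)) x := by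
    rw [contMDiffAt_pi_space]
    simpa only [happ] using hGc
  -- Inversion of operators is smooth at an invertible one, so invertibility at `x` suffices here;
  -- invertibility near `x` is what identifies this function with `c`.
  have hsol : ContMDiffAt I 𝓘(ℝ, ι → ℝ) n
      (fun y ↦ (Φ y).inverse (Φ y (fun i ↦ c i y))) x :=
    ((hinv.self_of_nhds.contDiffAt_map_inverse).contMDiffAt.comp x hΦ).clm_apply hb
  refine (contMDiffAt_pi_space.1 (hsol.congr_of_eventuallyEq (f₁ := fun y i ↦ c i y) ?_)) i
  filter_upwards [hinv] with y hy
  exact (hy.inverse_apply_eq.2 rfl).symm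

variable [IsManifold I ∞ M]

theorem IsSmoothField.mdiffAt {X : Π x : M, TangentSpace I x} (hX : IsSmoothField X) (x : M) :
    MDiffAt (T% X) x :=
  (hX x).mdifferentiableAt (by simp)

/-- The derivative of a smooth function along a smooth vector field is smooth. -/
theorem contMDiffAt_mvfderiv_apply {x : M} {f : M → ℝ} (hf : ContMDiff I 𝓘(ℝ) ∞ f)
    {Z : Π x : M, TangentSpace I x} (hZ : ContMDiffAt I I.tangent ∞ (T% Z) x) :
    ContMDiffAt I 𝓘(ℝ) ∞ (fun y ↦ d% f y (Z y)) x := by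
  -- `df(Z)` is the fibre component of the tangent map of `f` composed with `Z`.
  have h := ((hf.contMDiff_tangentMap (m := ∞) le_rfl).contMDiffAt (x := T% Z x)).comp x hZ
  have hsnd := (contMDiffAt_totalSpace.1 h).2
  simp only [Function.comp_apply, tangentMap, trivializationAt_model_space_apply] at hsnd
  exact hsnd

end Smoothness

/-! ### Smoothness of the gradient, rules for the connection, and the Hessian. -/

variable {E : Type*} [NormedAddCommGroup E] [NormedSpace ℝ E] [FiniteDimensional ℝ E]
  {H : Type*} [TopologicalSpace H] {I : ModelWithCorners ℝ E H}
  {M : Type*} [TopologicalSpace M] [ChartedSpace H M] [IsManifold I ∞ M]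
  [RiemannianBundle (fun x : M ↦ TangentSpace I x)]
  [IsContMDiffRiemannianBundle I ∞ E (fun x : M ↦ TangentSpace I x)]

/-- A vector field is smooth at `x` if its inner product with every field smooth at `x` is. -/
theorem contMDiffAt_of_inner {x : M} {V : Π x : M, TangentSpace I x}
    (hV : ∀ Z : Π x : M, TangentSpace I x, ContMDiffAt I I.tangent ∞ (T% Z) x →
      ContMDiffAt I 𝓘(ℝ) ∞ (fun y ↦ inner ℝ (V y) (Z y)) x) :
    ContMDiffAt I I.tangent ∞ (T% V) x := by
  classical
  let e := trivializationAt E (TangentSpace I : M → Type _) x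
  let b := Module.finBasis ℝ E
  have hx : x ∈ e.baseSet := mem_baseSet_trivializationAt ..
  have hfr := e.isLocalFrameOn_localFrame_baseSet I ∞ b
  have hs (i) : ContMDiffAt I I.tangent ∞ (T% (e.localFrame b i)) x :=
    hfr.contMDiffAt e.open_baseSet hx i
  refine hfr.contMDiffAt_of_coeff (fun i ↦ ?_) (e.open_baseSet.mem_nhds hx)
  refine contMDiffAt_of_linear_system (c := fun i y ↦ hfr.coeff i y (V y))
    (G := fun i j y ↦ inner ℝ (e.localFrame b i y) (e.localFrame b j y))
    (fun i j ↦ ContMDiffAt.inner_bundle (F := E) (E := fun x : M ↦ TangentSpace I x)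
      (hs i) (hs j)) (fun j ↦ ?_) ?_ i
  · refine (hV _ (hs j)).congr_of_eventuallyEq ?_
    filter_upwards [hfr.eventually_eq_sum_coeff_smul V (e.open_baseSet.mem_nhds hx)] with y hy
    conv_rhs => rw [hy]
    simp [sum_inner, inner_smul_left]
  -- The Gram matrix is nonsingular: a combination of the frame orthogonal to every frame vector
  -- vanishes.
  · filter_upwards [e.open_baseSet.mem_nhds hx] with y hy a ha
    have hv : ∑ i, a i • e.localFrame b i y = 0 := by
      refine InnerProductSpace.ext_inner_right_basis (𝕜 := ℝ) (hfr.toBasisAt hy) fun j ↦ ?_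
      rw [hfr.toBasisAt_coe, sum_inner, inner_zero_left, ← ha j]
      simp [inner_smul_left]
    exact funext (Fintype.linearIndependent_iff.1 (hfr.linearIndependent hy) a hv)

theorem isSmoothField_grad {f : M → ℝ} (hf : ContMDiff I 𝓘(ℝ) ∞ f) :
    IsSmoothField (grad f : Π x : M, TangentSpace I x) := fun x ↦
  contMDiffAt_of_inner fun Z hZ ↦ by
    simpa only [grad, inner_sharp] using contMDiffAt_mvfderiv_apply hf hZ

theorem leviCivita_add {x : M} {Y Z : Π x : M, TangentSpace I x}
    (hY : MDiffAt (T% Y) x) (hZ : MDiffAt (T% Z) x) :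
    leviCivita (fun y ↦ Y y + Z y) x = leviCivita Y x + leviCivita Z x :=
  leviCivita.isCovariantDerivativeOnUniv.add hY hZ

theorem leviCivita_smul {x : M} {a : M → ℝ} {Y : Π x : M, TangentSpace I x}
    (ha : MDiffAt a x) (hY : MDiffAt (T% Y) x) :
    leviCivita (fun y ↦ a y • Y y) x =
      a x • leviCivita Y x + (d% a x).smulRight (Y x) :=
  leviCivita.isCovariantDerivativeOnUniv.leibniz hY ha

theorem leviCivita_sub_swap {x : M} {X Y : Π x : M, TangentSpace I x}
    (hX : MDiffAt (T% X) x) (hY : MDiffAt (T% Y) x) :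
    leviCivita Y x (X x) - leviCivita X x (Y x) = mlieBracket I X Y x := by
  have := FiniteDimensional.complete ℝ E
  exact (CovariantDerivative.torsion_eq_zero_iff _).1 leviCivita_torsion hX hY

/-- The Hessian of `f` is `(X, Y) ↦ g(∇_X grad f, Y)`. -/
theorem hess_eq_inner {f : M → ℝ} {x : M} {X Y : Π x : M, TangentSpace I x}
    (hf : MDiffAt (T% (grad f : Π x : M, TangentSpace I x)) x)
    (hX : MDiffAt (T% X) x) (hY : MDiffAt (T% Y) x) :
    hess f X Y x = inner ℝ (leviCivita (grad f) x (X x)) (Y x) := by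
  have h := leviCivita_metric hX hf hY
  simp only [grad, inner_sharp] at h
  rw [hess, h]
  exact add_sub_cancel_right _ _

/-! ### Curvature of a field with ∇ξ = I - ξ♭ ⊗ ξ. -/

section

variable {ξ : Π x : M, TangentSpace I x}

/-- The differentiated field is ∇_Y ξ, so this is ∇_X ∇_Y ξ. The last coefficient is X(g(ξ, Y)),
expanded by metric compatibility and the equation for ∇ξ. -/
theorem leviCivita_sub_inner_smul {x : M} (hξ : MDiffAt (T% ξ) x)
    (h : leviCivita ξ x =
      ContinuousLinearMap.id ℝ (TangentSpace I x) - (flat ξ x).smulRight (ξ x))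
    {X Y : Π x : M, TangentSpace I x} (hX : MDiffAt (T% X) x) (hY : MDiffAt (T% Y) x) :
    leviCivita (fun y ↦ Y y - inner ℝ (ξ y) (Y y) • ξ y) x (X x) =
      leviCivita Y x (X x) - inner ℝ (ξ x) (Y x) • (X x - inner ℝ (ξ x) (X x) • ξ x)
        - (inner ℝ (X x) (Y x) - inner ℝ (ξ x) (X x) * inner ℝ (ξ x) (Y x)
          + inner ℝ (ξ x) (leviCivita Y x (X x))) • ξ x := by
  have ha : MDiffAt (fun y ↦ inner ℝ (ξ y) (Y y)) x := mdiffAt_inner hξ hY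
  have hna : MDiffAt (fun y ↦ -inner ℝ (ξ y) (Y y)) x := ha.neg
  have hd : d% (fun y ↦ -inner ℝ (ξ y) (Y y)) x (X x) =
      -(d% (fun y ↦ inner ℝ (ξ y) (Y y)) x (X x)) := by
    have := mvfderiv_neg (I := I) (g := fun y ↦ (inner ℝ (ξ y) (Y y) : ℝ)) (x := x)
    exact DFunLike.congr_fun this (X x)
  have hm := leviCivita_metric hX hξ hY
  -- The connection rules cover sums and function multiples, so the sign moves into the coefficient
  -- function.
  simp only [sub_eq_add_neg, ← neg_smul]
  rw [leviCivita_add hY (Z := fun y ↦ -inner ℝ (ξ y) (Y y) • ξ y) (hna.smul_section hξ),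
    leviCivita_smul hna hξ]
  simp only [add_apply, smul_apply, ContinuousLinearMap.smulRight_apply, hd, hm, h,
    sub_apply, ContinuousLinearMap.id_apply, flat, innerSL_apply_apply, inner_sub_left,
    inner_smul_left, RCLike.conj_to_real]
  module

/-- If `∇ξ = I - ξ♭ ⊗ ξ`, then `R(X, Y)ξ = g(ξ, X)Y - g(ξ, Y)X`. -/
theorem curvature_of_leviCivita_eq
    (h : ∀ x, leviCivita ξ x =
      ContinuousLinearMap.id ℝ (TangentSpace I x) - (flat ξ x).smulRight (ξ x))
    {x : M} (hξ : MDiffAt (T% ξ) x)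
    {X Y : Π x : M, TangentSpace I x} (hX : MDiffAt (T% X) x) (hY : MDiffAt (T% Y) x) :
    curvature X Y ξ x = inner ℝ (ξ x) (X x) • Y x - inner ℝ (ξ x) (Y x) • X x := by
  have hφ (Z : Π x : M, TangentSpace I x) : (fun y ↦ leviCivita ξ y (Z y)) =
      fun y ↦ Z y - inner ℝ (ξ y) (Z y) • ξ y := by
    funext y
    simp [h y, flat]
  rw [curvature, hφ, hφ, leviCivita_sub_inner_smul hξ (h x) hX hY,
    leviCivita_sub_inner_smul hξ (h x) hY hX, ← leviCivita_sub_swap hX hY, h x,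
    real_inner_comm (X x) (Y x)]
  simp only [sub_apply, ContinuousLinearMap.id_apply, ContinuousLinearMap.smulRight_apply, flat,
    innerSL_apply_apply, inner_sub_right]
  module

/-- If `∇ξ = I - ξ♭ ⊗ ξ`, then `S(ξ, ξ) = (1 - dim M)|ξ|²`. -/
theorem ricci_of_leviCivita_eq
    (h : ∀ x, leviCivita ξ x =
      ContinuousLinearMap.id ℝ (TangentSpace I x) - (flat ξ x).smulRight (ξ x))
    {x : M} (hξ : MDiffAt (T% ξ) x) :
    ricci ξ ξ x = (1 - (Module.finrank ℝ E : ℝ)) * ‖ξ x‖ ^ 2 := by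
  let b := stdOrthonormalBasis ℝ (TangentSpace I x)
  have hterm (i) : inner ℝ (curvature (extend E (b i)) ξ ξ x) (b i) =
      inner ℝ (ξ x) (b i) * inner ℝ (b i) (ξ x) - ‖ξ x‖ ^ 2 := by
    rw [curvature_of_leviCivita_eq h hξ (mdifferentiableAt_extend (I := I) (F := E) (b i)) hξ,
      extend_apply_self, inner_sub_left, inner_smul_left, inner_smul_left,
      real_inner_self_eq_norm_sq (b i), b.orthonormal.1 i, real_inner_self_eq_norm_sq,
      real_inner_comm (ξ x) (b i)]
    simp
  have hdim : Module.finrank ℝ (TangentSpace I x) = Module.finrank ℝ E := rfl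
  -- By Parseval the first terms sum to |ξ|²; the second contribute -|ξ|² once per basis vector.
  rw [ricci, Finset.sum_congr rfl fun i _ ↦ hterm i, Finset.sum_sub_distrib,
    b.sum_inner_mul_inner, real_inner_self_eq_norm_sq]
  simp [hdim]
  ring

end

end RiemGeom

end

theorem mainTheorem7 {m : ℕ} {M : Type*} [TopologicalSpace M]
    [ChartedSpace (EuclideanSpace ℝ (Fin m)) M] [IsManifold (𝓡 m) ∞ M]
    [RiemannianBundle (fun x : M ↦ TangentSpace (𝓡 m) x)]
    [IsContMDiffRiemannianBundle (𝓡 m) ∞ (EuclideanSpace ℝ (Fin m))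
      (fun x : M ↦ TangentSpace (𝓡 m) x)]
    (f : M → ℝ) (hf : ContMDiff (𝓡 m) 𝓘(ℝ) ∞ f)
    (ξ : Π x : M, TangentSpace (𝓡 m) x) (hξ : ξ = RiemGeom.grad f)
    (η : Π x : M, TangentSpace (𝓡 m) x →L[ℝ] ℝ) (hη : η = RiemGeom.flat ξ)
    (h : ∀ x : M, RiemGeom.leviCivita ξ x =
      ContinuousLinearMap.id ℝ (TangentSpace (𝓡 m) x) - (η x).smulRight (ξ x)) :
    (∀ X Y : Π x : M, TangentSpace (𝓡 m) x,
      RiemGeom.IsSmoothField X → RiemGeom.IsSmoothField Y → ∀ x : M,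
      RiemGeom.hess f X Y x = inner ℝ (X x) (Y x) - η x (X x) * η x (Y x)) ∧
    (∀ X Y : Π x : M, TangentSpace (𝓡 m) x,
      RiemGeom.IsSmoothField X → RiemGeom.IsSmoothField Y → ∀ x : M,
      RiemGeom.curvature X Y ξ x = η x (X x) • Y x - η x (Y x) • X x) ∧
    (∀ x : M, RiemGeom.ricci ξ ξ x = (1 - (m : ℝ)) * ‖ξ x‖ ^ 2) := by
  have hs : RiemGeom.IsSmoothField ξ := hξ ▸ RiemGeom.isSmoothField_grad hf
  subst hη
  refine ⟨fun X Y hX hY x ↦ ?_, fun X Y hX hY x ↦ ?_, fun x ↦ ?_⟩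
  · rw [RiemGeom.hess_eq_inner (hξ ▸ hs.mdiffAt x) (hX.mdiffAt x) (hY.mdiffAt x), ← hξ, h x]
    simp [RiemGeom.flat, inner_sub_left, inner_smul_left]
  · exact RiemGeom.curvature_of_leviCivita_eq h (hs.mdiffAt x) (hX.mdiffAt x) (hY.mdiffAt x)
  · simpa using RiemGeom.ricci_of_leviCivita_eq h (hs.mdiffAt x)
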